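/- Let $A,Q\in\mathbb R^{n\times n}$ with $Q$ symmetric positive definite, let $C\in\mathbb R^{m\times n}$ have rows $C_1,\dots,C_m$ with $(C,A)$ observable, and let $r_1,\dots,r_m>0$. Let $G=(V,E)$ be a directed graph on $V=\{s_0,s_1,\dots,s_m\}$ ($s_0$ is the fusion center, $s_1,\dots,s_m$ are the sensors) that is a tree directed towards $s_0$, i.e. every vertex has one and only one directed path to $s_0$. Let each edge $e\in E$ have an energy cost $c(e)\in\mathbb R$, and let $c_i$ be the cost of the only edge that leaves $s_i$. Let the energy budget $\mathcal E_d$ satisfy $0<\mathcal E_d\le\sum_{i=1}^m c_i$. Let $\mathcal T$ be the set of all subtrees $T=(V_T,E_T)$ of $G$ with $s_0\in V_T$, let $\mathcal E(T)=\sum_{e\in E_T}c(e)$, and let $$\mathcal P=\Big\{p\in\mathbb R^m : \exists\,(\pi_T)_{T\in\mathcal T},\ \pi_T\ge0,\ \sum_{T\in\mathcal T}\pi_T=1,\ \sum_{T\in\mathcal T}\pi_T\mathcal E(T)\le\mathcal E_d,\ p_i=\sum_{T\ni s_i}\pi_T\ (1\le i\le m)\Big\}.$$ For $X\succeq0$ put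 $$L(X,p)=\Big[(AXA'+Q)^{-1}+\sum_{i=1}^m p_i\,\frac{C_i'C_i}{r_i}\Big]^{-1},$$ $L^{(1)}=L$, $L^{(k)}(X,p)=L(L^{(k-1)}(X,p),p)$, and $L^\infty(X,p)=\lim_{k\to\infty}L^{(k)}(X,p)$ when the limit exists. Consider the following algorithm. Start with $p_0=\big(\mathcal E_d/\sum_{i=1}^m c_i\big)\mathbf 1_m$ and $L_0=L^\infty(I_n,p_0)$. For $k\ge1$ let $p_k$ be any solution of the problem $$\text{minimize } \operatorname{trace}\,L(L_{k-1},p)\quad\text{subject to } p\in\mathcal P,\ L(L_{k-1},p)\preceq L_{k-1}\qquad(\ast)$$ and put $L_k=L(L_{k-1},p_k)$. Theorem. (1) $L_0$ exists. (2) Whatever choices were made in the preceding steps, problem $(\ast)$ is feasible, and has a solution, at every step; in particular the algorithm can be run indefinitely. Moreover, for all sequences $(L_k)$, $(p_k)$ that the algorithm can produce: (3) $(p_k)$ has an accumulation point (a limit of a convergent subsequence), and every accumulation point $p^*$ lies in $\mathcal P$. (4) The sequence $(L_k)$ is decreasing in the Loewner order and $L_\infty=\lim_{k\to\infty}L_k$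 exists. (5) For every accumulation point $p^*$ of $(p_k)$ and every positive semidefinite $X$, the limit $L^\infty(X,p^*)$ exists and equals $L_\infty$. -/

import Mathlib

open Filter Topology

/-- The data of the sensor selection problem: the dynamics matrix `A`, the process noise
covariance `Q`, the observation matrix `C` (row `i` belongs to sensor `i`), the measurement noise
variances `r`, the edge set and the link energies of the communication graph, and the energy
budget. The vertices of the graph are `Fin (m + 1)`: the fusion center is `0`, and the sensor with
index `i : Fin m` is the vertex `i.succ`. -/
structure SensorModel (n m : ℕ) where
  A : Matrix (Fin n) (Fin n) ℝ
  Q : Matrix (Fin n) (Fin n) ℝ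
  C : Matrix (Fin m) (Fin n) ℝ
  r : Fin m → ℝ
  edges : Finset (Fin (m + 1) × Fin (m + 1))
  cost : Fin (m + 1) × Fin (m + 1) → ℝ
  budget : ℝ

/-- The pair `(C, A)` is observable: the only initial state of `x (k + 1) = A x k` with output
`C x k = 0` for all times `k` is `0`. -/
def IsObservable {n m : ℕ} (C : Matrix (Fin m) (Fin n) ℝ) (A : Matrix (Fin n) (Fin n) ℝ) : Prop :=
  ∀ x : Fin n → ℝ, (∀ k : ℕ, (C * A ^ k).mulVec x = 0) → x = 0

/-- `l` is the list of vertices of a directed path from `u` to `v` along the edges in `E`. -/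
def IsDirectedPath {V : Type*} (E : Finset (V × V)) (u v : V) (l : List V) : Prop :=
  l.head? = some u ∧ l.getLast? = some v ∧ l.IsChain (fun a b => (a, b) ∈ E)

/-- The directed graph with vertex set `W` and edge set `E` is a tree directed towards its root
`s`: every vertex has one and only one directed path to `s`. (Vertices of a path may repeat here,
so that uniqueness also rules out cycles and edges that leave the root.) -/
def IsDirectedTree {V : Type*} (s : V) (W : Finset V) (E : Finset (V × V)) : Prop :=
  s ∈ W ∧ (∀ e ∈ E, e.1 ∈ W ∧ e.2 ∈ W) ∧ ∀ u ∈ W, ∃! l : List V, IsDirectedPath E u s l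

namespace SensorModel

noncomputable section

variable {n m : ℕ} (S : SensorModel n m)

/-- `L(X, p) = ((A X A' + Q)⁻¹ + ∑ i, p i * (C i' C i) / r i)⁻¹`. -/
def L (X : Matrix (Fin n) (Fin n) ℝ) (p : Fin m → ℝ) : Matrix (Fin n) (Fin n) ℝ :=
  ((S.A * X * S.A.transpose + S.Q)⁻¹ +
    ∑ i, (p i / S.r i) • Matrix.vecMulVec (S.C i) (S.C i))⁻¹

/-- The iterates `L^(k)(X, p)` of `L(·, p)`, with `L^(0)(X, p) = X`. -/
def iterL (k : ℕ) (X : Matrix (Fin n) (Fin n) ℝ) (p : Fin m → ℝ) : Matrix (Fin n) (Fin n) ℝ :=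
  (fun Y => S.L Y p)^[k] X

/-- The limit `L^∞(X, p)` exists and equals `M`. -/
def HasLimitL (X : Matrix (Fin n) (Fin n) ℝ) (p : Fin m → ℝ) (M : Matrix (Fin n) (Fin n) ℝ) :
    Prop :=
  Tendsto (fun k => S.iterL k X p) atTop (𝓝 M)

open Classical in
/-- The set of transmission topologies: all subtrees `T = (V_T, E_T)` of the communication graph
that contain the fusion center. -/
def trees : Finset (Finset (Fin (m + 1)) × Finset (Fin (m + 1) × Fin (m + 1))) :=
  Finset.univ.filter fun T => T.2 ⊆ S.edges ∧ IsDirectedTree 0 T.1 T.2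

/-- The energy `∑ e ∈ E_T, c(e)` consumed by a transmission topology. -/
def energy (T : Finset (Fin (m + 1)) × Finset (Fin (m + 1) × Fin (m + 1))) : ℝ :=
  ∑ e ∈ T.2, S.cost e

/-- The energy `c i` of sensor `i`: the cost of its outgoing link. In a tree there is exactly one
such link, so the sum has one term. -/
def sensorCost (i : Fin m) : ℝ :=
  ∑ e ∈ S.edges with e.1 = i.succ, S.cost e

/-- The set of feasible marginals: those `p` for which some probability vector `π` on the
transmission topologies has expected energy at most the budget and selects sensor `i` with
probability `p i`, for every `i`. -/
def feasibleMarginals : Set (Fin m → ℝ) :=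
  {p | ∃ π : Finset (Fin (m + 1)) × Finset (Fin (m + 1) × Fin (m + 1)) → ℝ,
    (∑ T ∈ S.trees, π T * S.energy T ≤ S.budget) ∧
    (∀ T ∈ S.trees, 0 ≤ π T) ∧
    (∑ T ∈ S.trees, π T = 1) ∧
    ∀ i : Fin m, p i = ∑ T ∈ S.trees with i.succ ∈ T.1, π T}

/-- The initial vector: all entries equal to `budget / ∑ i, c i`. -/
def initialMarginals : Fin m → ℝ :=
  fun _ => S.budget / ∑ i, S.sensorCost i

/-- The feasible set of the subproblem with previous matrix `Y`: all feasible marginals `q` with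
`L(Y, q) ≤ Y` in the Loewner order. -/
def subproblemSet (Y : Matrix (Fin n) (Fin n) ℝ) : Set (Fin m → ℝ) :=
  {q | q ∈ S.feasibleMarginals ∧ (Y - S.L Y q).PosSemidef}

/-- `q` solves the subproblem with previous matrix `Y`: it minimizes `trace (L(Y, q))` over the
feasible set. -/
def IsSubproblemSolution (Y : Matrix (Fin n) (Fin n) ℝ) (q : Fin m → ℝ) : Prop :=
  q ∈ S.subproblemSet Y ∧ ∀ q' ∈ S.subproblemSet Y, (S.L Y q).trace ≤ (S.L Y q').trace

/-- `Lk 0, …, Lk N` and `pk 0, …, pk N` are the outcome of the first `N` steps of the algorithm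
(with any choice among the minimizers, where there are several). -/
def IsRunUpTo (N : ℕ) (Lk : ℕ → Matrix (Fin n) (Fin n) ℝ) (pk : ℕ → Fin m → ℝ) : Prop :=
  pk 0 = S.initialMarginals ∧ S.HasLimitL 1 S.initialMarginals (Lk 0) ∧
    ∀ k < N, S.IsSubproblemSolution (Lk k) (pk (k + 1)) ∧ Lk (k + 1) = S.L (Lk k) (pk (k + 1))

/-- An infinite run of the algorithm. -/
def IsRun (Lk : ℕ → Matrix (Fin n) (Fin n) ℝ) (pk : ℕ → Fin m → ℝ) : Prop :=
  ∀ N, S.IsRunUpTo N Lk pk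

end

end SensorModel

/-- `x` is an accumulation point of the sequence `u`: the limit of a convergent subsequence. -/
def IsAccumulationPoint {α : Type*} [TopologicalSpace α] (u : ℕ → α) (x : α) : Prop :=
  ∃ φ : ℕ → ℕ, StrictMono φ ∧ Tendsto (u ∘ φ) atTop (𝓝 x)

/-! All matrix inequalities are read through quadratic forms. The information term of `L` does not
depend on `X`, so enlarging the prediction covariance by a factor `c ≥ 1` enlarges `L` by at most
`c` (`quadVal_L_le_of_predict_le`). If `P` is a fixed point of `L(·, p)` and `Q ≥ ε (A P A' + Q)`,
the additive noise `Q` turns this into a contraction: the bounds `s P ≤ X ≤ t P` improve under `L`,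
with `1 - s` and `t - 1` multiplied by `1 - ε`. Hence every positive definite fixed point attracts
all positive semidefinite `X` (`hasLimitL_of_fixed`), and only fixed points have to be found.

For the positive vector `p₀`, the iterates from `0` increase. Observability bounds them in every
direction, so they converge to a fixed point (`exists_fixed`), and this gives `L₀`. The vector `p₀`
is feasible as a mixture of the full tree and the bare root.

By monotonicity of `L`, each `p_k` stays feasible for the next problem, and compactness of the
feasible marginals gives minimizers and accumulation points. The constraint makes `L_k` decrease to
some limit `M`. Passing to the limit in the recursion along a subsequence gives `L(M, p*) = M`. So
`M` is positive definite and attracts every `X`, without any positivity of the entries of `p*`. -/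

/-! ### Quadratic forms, the Loewner order and inverses -/

section QuadraticForms

open Matrix

variable {ι : Type*} [Fintype ι]

/-- The value `x' M x` of the quadratic form of `M` at `x`. -/
def quadVal (M : Matrix ι ι ℝ) (x : ι → ℝ) : ℝ := x ⬝ᵥ (M *ᵥ x)

lemma quadVal_add (M N : Matrix ι ι ℝ) (x : ι → ℝ) :
    quadVal (M + N) x = quadVal M x + quadVal N x := by
  simp [quadVal, add_mulVec]

lemma quadVal_sub (M N : Matrix ι ι ℝ) (x : ι → ℝ) :
    quadVal (M - N) x = quadVal M x - quadVal N x := by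
  simp [quadVal, sub_mulVec]

lemma quadVal_smul (c : ℝ) (M : Matrix ι ι ℝ) (x : ι → ℝ) :
    quadVal (c • M) x = c * quadVal M x := by
  simp [quadVal, smul_mulVec]

lemma quadVal_smul_vec (c : ℝ) (M : Matrix ι ι ℝ) (x : ι → ℝ) :
    quadVal M (c • x) = c ^ 2 * quadVal M x := by
  simp [quadVal, mulVec_smul]; ring

lemma quadVal_sum {κ : Type*} (s : Finset κ) (M : κ → Matrix ι ι ℝ) (x : ι → ℝ) :
    quadVal (∑ i ∈ s, M i) x = ∑ i ∈ s, quadVal (M i) x := by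
  simp [quadVal, sum_mulVec, dotProduct_sum]

lemma quadVal_vecMulVec (c x : ι → ℝ) : quadVal (vecMulVec c c) x = (c ⬝ᵥ x) ^ 2 := by
  simp [quadVal, vecMulVec_mulVec, dotProduct_smul, dotProduct_comm x c, sq]

lemma quadVal_mul_mul_transpose {κ : Type*} [Fintype κ] (A : Matrix κ ι ℝ) (X : Matrix ι ι ℝ)
    (x : κ → ℝ) : quadVal (A * X * Aᵀ) x = quadVal X (Aᵀ *ᵥ x) := by
  simp only [quadVal, ← mulVec_mulVec]
  rw [dotProduct_mulVec, ← mulVec_transpose]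

@[simp] lemma quadVal_zero_vec (M : Matrix ι ι ℝ) : quadVal M 0 = 0 := by simp [quadVal]

lemma continuous_quadVal (M : Matrix ι ι ℝ) : Continuous (quadVal M) := by
  unfold quadVal
  fun_prop

lemma continuous_quadVal_matrix (x : ι → ℝ) :
    Continuous (fun M : Matrix ι ι ℝ => quadVal M x) := by
  unfold quadVal
  fun_prop

lemma posSemidef_iff_quadVal {M : Matrix ι ι ℝ} :
    M.PosSemidef ↔ M.IsHermitian ∧ ∀ x, 0 ≤ quadVal M x := by
  simp [posSemidef_iff_dotProduct_mulVec, quadVal]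

lemma posDef_iff_quadVal {M : Matrix ι ι ℝ} :
    M.PosDef ↔ M.IsHermitian ∧ ∀ x, x ≠ 0 → 0 < quadVal M x := by
  simp [posDef_iff_dotProduct_mulVec, quadVal]

lemma Matrix.PosSemidef.quadVal_nonneg {M : Matrix ι ι ℝ} (hM : M.PosSemidef) (x : ι → ℝ) :
    0 ≤ quadVal M x := (posSemidef_iff_quadVal.1 hM).2 x

lemma Matrix.PosDef.quadVal_pos {M : Matrix ι ι ℝ} (hM : M.PosDef) {x : ι → ℝ} (hx : x ≠ 0) :
    0 < quadVal M x := (posDef_iff_quadVal.1 hM).2 x hx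

lemma posSemidef_sub_iff {M N : Matrix ι ι ℝ} (hM : M.IsHermitian) (hN : N.IsHermitian) :
    (N - M).PosSemidef ↔ ∀ x, quadVal M x ≤ quadVal N x := by
  simp only [posSemidef_iff_quadVal, hN.sub hM, quadVal_sub, sub_nonneg, true_and]

lemma Matrix.IsHermitian.dotProduct_mulVec_symm {M : Matrix ι ι ℝ} (hM : M.IsHermitian)
    (x y : ι → ℝ) : x ⬝ᵥ (M *ᵥ y) = y ⬝ᵥ (M *ᵥ x) := by
  have h : Mᵀ = M := by simpa [IsHermitian] using hM
  rw [dotProduct_mulVec, ← mulVec_transpose, h, dotProduct_comm]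

lemma quadVal_add_vec {M : Matrix ι ι ℝ} (hM : M.IsHermitian) (x y : ι → ℝ) :
    quadVal M (x + y) = quadVal M x + 2 * (x ⬝ᵥ (M *ᵥ y)) + quadVal M y := by
  simp only [quadVal, mulVec_add, dotProduct_add, add_dotProduct, hM.dotProduct_mulVec_symm y x]
  ring

lemma quadVal_sub_vec {M : Matrix ι ι ℝ} (hM : M.IsHermitian) (x y : ι → ℝ) :
    quadVal M (x - y) = quadVal M x - 2 * (x ⬝ᵥ (M *ᵥ y)) + quadVal M y := by
  simp only [quadVal, mulVec_sub, dotProduct_sub, sub_dotProduct, hM.dotProduct_mulVec_symm y x]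
  ring

lemma quadVal_add_vec_le {M : Matrix ι ι ℝ} (hM : M.PosSemidef) (x y : ι → ℝ) :
    quadVal M (x + y) ≤ 2 * quadVal M x + 2 * quadVal M y := by
  have h := hM.quadVal_nonneg (x - y)
  rw [quadVal_sub_vec hM.1] at h
  rw [quadVal_add_vec hM.1]
  linarith

/-- A positive definite matrix dominates every matrix up to a factor. -/
lemma Matrix.PosDef.exists_quadVal_le {P : Matrix ι ι ℝ} (hP : P.PosDef) (X : Matrix ι ι ℝ) :
    ∃ t : ℝ, 1 ≤ t ∧ ∀ x, quadVal X x ≤ t * quadVal P x := by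
  -- The ratio of the two forms is bounded on the unit sphere, and by homogeneity everywhere.
  have hcont : ContinuousOn (fun x => quadVal X x / quadVal P x)
      (Metric.sphere (0 : ι → ℝ) 1) := by
    refine (continuous_quadVal X).continuousOn.div (continuous_quadVal P).continuousOn ?_
    intro x hx
    refine (hP.quadVal_pos ?_).ne'
    rintro rfl
    simp at hx
  obtain ⟨c, hc⟩ := (isCompact_sphere (0 : ι → ℝ) 1).exists_bound_of_continuousOn hcont
  refine ⟨max 1 c, le_max_left _ _, fun x => ?_⟩
  rcases eq_or_ne x 0 with rfl | hx
  · simp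
  have hx' : 0 < ‖x‖ := norm_pos_iff.2 hx
  have hs : ‖x‖⁻¹ • x ∈ Metric.sphere (0 : ι → ℝ) 1 := by
    simp [norm_smul, hx'.ne']
  have h1 := (le_abs_self _).trans (hc _ hs)
  simp only [quadVal_smul_vec] at h1
  rw [mul_div_mul_left _ _ (by positivity), div_le_iff₀ (hP.quadVal_pos hx)] at h1
  exact h1.trans (mul_le_mul_of_nonneg_right (le_max_right _ _) (hP.quadVal_pos hx).le)

lemma Matrix.PosSemidef.of_tendsto {F : ℕ → Matrix ι ι ℝ} {M : Matrix ι ι ℝ}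
    (hF : ∀ k, (F k).PosSemidef) (h : Tendsto F atTop (𝓝 M)) : M.PosSemidef := by
  refine posSemidef_iff_quadVal.2 ⟨?_, fun x => ?_⟩
  · have h1 : Tendsto (fun k => (F k)ᴴ) atTop (𝓝 Mᴴ) :=
      (Continuous.matrix_conjTranspose continuous_id).continuousAt.tendsto.comp h
    simp only [fun k => show (F k)ᴴ = F k from (hF k).1] at h1
    exact tendsto_nhds_unique h1 h
  · exact ge_of_tendsto' ((continuous_quadVal_matrix x).continuousAt.tendsto.comp h)
      fun k => (hF k).quadVal_nonneg x

variable [DecidableEq ι]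

/-- Polarization: it reduces convergence of symmetric matrices to convergence of their quadratic
forms. -/
lemma Matrix.IsHermitian.apply_eq_quadVal {M : Matrix ι ι ℝ} (hM : M.IsHermitian) (i j : ι) :
    M i j = (quadVal M (Pi.single i 1 + Pi.single j 1) - quadVal M (Pi.single i 1) -
      quadVal M (Pi.single j 1)) / 2 := by
  rw [quadVal_add_vec hM]
  simp only [mulVec_single_one, single_one_dotProduct, col_apply]
  ring

lemma tendsto_of_tendsto_quadVal {F : ℕ → Matrix ι ι ℝ} {M : Matrix ι ι ℝ}
    (hF : ∀ k, (F k).IsHermitian) (hM : M.IsHermitian)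
    (h : ∀ x, Tendsto (fun k => quadVal (F k) x) atTop (𝓝 (quadVal M x))) :
    Tendsto F atTop (𝓝 M) := by
  refine tendsto_pi_nhds.2 fun i => tendsto_pi_nhds.2 fun j => ?_
  simp only [(hF _).apply_eq_quadVal i j, hM.apply_eq_quadVal i j]
  exact (((h _).sub (h _)).sub (h _)).div_const 2

lemma exists_tendsto_of_tendsto_quadVal {F : ℕ → Matrix ι ι ℝ} (hF : ∀ k, (F k).IsHermitian)
    (h : ∀ x, ∃ c, Tendsto (fun k => quadVal (F k) x) atTop (𝓝 c)) :
    ∃ M, Tendsto F atTop (𝓝 M) := by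
  choose c hc using h
  refine ⟨fun i j => (c (Pi.single i 1 + Pi.single j 1) - c (Pi.single i 1) -
    c (Pi.single j 1)) / 2, tendsto_pi_nhds.2 fun i => tendsto_pi_nhds.2 fun j => ?_⟩
  simp only [(hF _).apply_eq_quadVal i j]
  exact (((hc _).sub (hc _)).sub (hc _)).div_const 2

/-- A sequence that is decreasing in the Loewner order and bounded below by `0` converges. -/
lemma exists_tendsto_of_antitone {F : ℕ → Matrix ι ι ℝ} (hF : ∀ k, (F k).PosSemidef)
    (h : ∀ x, Antitone fun k => quadVal (F k) x) : ∃ M, Tendsto F atTop (𝓝 M) :=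
  exists_tendsto_of_tendsto_quadVal (fun k => (hF k).1) fun x =>
    ⟨_, tendsto_atTop_ciInf (h x) ⟨0, by rintro _ ⟨k, rfl⟩; exact (hF k).quadVal_nonneg x⟩⟩

/-- A sequence that is increasing in the Loewner order and bounded above converges. -/
lemma exists_tendsto_of_monotone {F : ℕ → Matrix ι ι ℝ} (hF : ∀ k, (F k).PosSemidef)
    (h : ∀ x, Monotone fun k => quadVal (F k) x) (hb : ∀ x, ∃ c, ∀ k, quadVal (F k) x ≤ c) :
    ∃ M, Tendsto F atTop (𝓝 M) :=
  exists_tendsto_of_tendsto_quadVal (fun k => (hF k).1) fun x =>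
    ⟨_, tendsto_atTop_ciSup (h x) (by
      obtain ⟨c, hc⟩ := hb x
      exact ⟨c, by rintro _ ⟨k, rfl⟩; exact hc k⟩)⟩

lemma Matrix.PosDef.inv_mulVec_mulVec {M : Matrix ι ι ℝ} (hM : M.PosDef) (x : ι → ℝ) :
    M *ᵥ (M⁻¹ *ᵥ x) = x := by
  rw [mulVec_mulVec, mul_nonsing_inv _ ((isUnit_iff_isUnit_det _).1 hM.isUnit), one_mulVec]

/-- The Fenchel inequality for the dual quadratic forms of `M` and `M⁻¹`. -/
lemma Matrix.PosDef.two_mul_dotProduct_le {M : Matrix ι ι ℝ} (hM : M.PosDef) (x u : ι → ℝ) :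
    2 * (x ⬝ᵥ u) ≤ quadVal M x + quadVal M⁻¹ u := by
  -- Expanding the form at `x - M⁻¹ u` gives the inequality; equality holds at `x = M⁻¹ u`.
  have h := hM.posSemidef.quadVal_nonneg (x - M⁻¹ *ᵥ u)
  rw [quadVal_sub_vec hM.1, hM.inv_mulVec_mulVec] at h
  have h2 : quadVal M (M⁻¹ *ᵥ u) = quadVal M⁻¹ u := by
    rw [quadVal, hM.inv_mulVec_mulVec, dotProduct_comm, quadVal]
  linarith

/-- The Fenchel inequality for `M` at the point `N⁻¹ u`, where the one for `N` is an equality. -/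
lemma quadVal_inv_le_quadVal_inv {M N : Matrix ι ι ℝ} (hM : M.PosDef) (hN : N.PosDef)
    (h : ∀ x, quadVal M x ≤ quadVal N x) (u : ι → ℝ) : quadVal N⁻¹ u ≤ quadVal M⁻¹ u := by
  have h1 := hM.two_mul_dotProduct_le (N⁻¹ *ᵥ u) u
  have h2 : quadVal N (N⁻¹ *ᵥ u) = quadVal N⁻¹ u := by
    rw [quadVal, hN.inv_mulVec_mulVec, dotProduct_comm, quadVal]
  have h3 : (N⁻¹ *ᵥ u) ⬝ᵥ u = quadVal N⁻¹ u := by rw [dotProduct_comm, quadVal]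
  have h4 := h (N⁻¹ *ᵥ u)
  linarith

lemma quadVal_smul_inv {c : ℝ} (hc : 0 < c) {M : Matrix ι ι ℝ} (hM : M.PosDef) (u : ι → ℝ) :
    quadVal (c • M)⁻¹ u = c⁻¹ * quadVal M⁻¹ u := by
  have : (c • M)⁻¹ = c⁻¹ • M⁻¹ := by
    refine inv_eq_right_inv ?_
    rw [smul_mul_smul_comm, mul_inv_cancel₀ hc.ne', one_smul,
      mul_nonsing_inv _ ((isUnit_iff_isUnit_det _).1 hM.isUnit)]
  rw [this, quadVal_smul]

lemma Matrix.PosDef.continuousAt_inv {M : Matrix ι ι ℝ} (hM : M.PosDef) :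
    ContinuousAt (Inv.inv : Matrix ι ι ℝ → Matrix ι ι ℝ) M := by
  refine continuousAt_matrix_inv M ?_
  have : (Ring.inverse : ℝ → ℝ) = Inv.inv := by ext; simp
  rw [this]
  exact continuousAt_inv₀ ((isUnit_iff_isUnit_det _).1 hM.isUnit).ne_zero

end QuadraticForms

/-! ### The Riccati map: contraction, observability, fixed points -/

namespace SensorModel

section Riccati

open Matrix

variable {n m : ℕ} {S : SensorModel n m}

variable (S) in
/-- The covariance `A X A' + Q` of the prediction. -/
def predict (X : Matrix (Fin n) (Fin n) ℝ) : Matrix (Fin n) (Fin n) ℝ :=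
  S.A * X * S.Aᵀ + S.Q

variable (S) in
/-- The information `∑ i, p i * (C i' C i) / r i` gained from the measurements. -/
noncomputable def information (p : Fin m → ℝ) : Matrix (Fin n) (Fin n) ℝ :=
  ∑ i, (p i / S.r i) • vecMulVec (S.C i) (S.C i)

lemma L_eq (X : Matrix (Fin n) (Fin n) ℝ) (p : Fin m → ℝ) :
    S.L X p = ((S.predict X)⁻¹ + S.information p)⁻¹ := rfl

lemma quadVal_predict (X : Matrix (Fin n) (Fin n) ℝ) (x : Fin n → ℝ) :
    quadVal (S.predict X) x = quadVal X (S.Aᵀ *ᵥ x) + quadVal S.Q x := by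
  rw [predict, quadVal_add, quadVal_mul_mul_transpose]

lemma quadVal_information (p : Fin m → ℝ) (x : Fin n → ℝ) :
    quadVal (S.information p) x = ∑ i, p i / S.r i * (S.C i ⬝ᵥ x) ^ 2 := by
  simp [information, quadVal_sum, quadVal_smul, quadVal_vecMulVec]

lemma posDef_predict (hQ : S.Q.PosDef) {X : Matrix (Fin n) (Fin n) ℝ} (hX : X.PosSemidef) :
    (S.predict X).PosDef := by
  have h := hX.mul_mul_conjTranspose_same S.A
  rw [conjTranspose_eq_transpose_of_trivial] at h
  exact Matrix.PosDef.posSemidef_add h hQ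

lemma posSemidef_information (hr : ∀ i, 0 < S.r i) {p : Fin m → ℝ} (hp : ∀ i, 0 ≤ p i) :
    (S.information p).PosSemidef :=
  posSemidef_sum _ fun i _ =>
    (by simpa using posSemidef_vecMulVec_self_star (S.C i) :
      (vecMulVec (S.C i) (S.C i)).PosSemidef).smul (div_nonneg (hp i) (hr i).le)

lemma posDef_inv_predict_add_information (hQ : S.Q.PosDef) (hr : ∀ i, 0 < S.r i)
    {X : Matrix (Fin n) (Fin n) ℝ} (hX : X.PosSemidef) {p : Fin m → ℝ} (hp : ∀ i, 0 ≤ p i) :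
    ((S.predict X)⁻¹ + S.information p).PosDef :=
  (posDef_predict hQ hX).inv.add_posSemidef (posSemidef_information hr hp)

lemma posDef_L (hQ : S.Q.PosDef) (hr : ∀ i, 0 < S.r i)
    {X : Matrix (Fin n) (Fin n) ℝ} (hX : X.PosSemidef) {p : Fin m → ℝ} (hp : ∀ i, 0 ≤ p i) :
    (S.L X p).PosDef :=
  (posDef_inv_predict_add_information hQ hr hX hp).inv

lemma iterL_succ (k : ℕ) (X : Matrix (Fin n) (Fin n) ℝ) (p : Fin m → ℝ) :
    S.iterL (k + 1) X p = S.L (S.iterL k X p) p := by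
  simp [iterL, Function.iterate_succ_apply']

lemma posSemidef_iterL (hQ : S.Q.PosDef) (hr : ∀ i, 0 < S.r i)
    {X : Matrix (Fin n) (Fin n) ℝ} (hX : X.PosSemidef) {p : Fin m → ℝ} (hp : ∀ i, 0 ≤ p i)
    (k : ℕ) : (S.iterL k X p).PosSemidef := by
  induction k with
  | zero => exact hX
  | succ k ih => rw [iterL_succ]; exact (posDef_L hQ hr ih hp).posSemidef

lemma continuousAt_L (hQ : S.Q.PosDef) (hr : ∀ i, 0 < S.r i)
    {X : Matrix (Fin n) (Fin n) ℝ} (hX : X.PosSemidef) {p : Fin m → ℝ} (hp : ∀ i, 0 ≤ p i) :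
    ContinuousAt (fun Y : Matrix (Fin n) (Fin n) ℝ × (Fin m → ℝ) => S.L Y.1 Y.2) (X, p) := by
  have h1 : Continuous fun Y : Matrix (Fin n) (Fin n) ℝ × (Fin m → ℝ) => S.predict Y.1 := by
    unfold predict
    fun_prop
  have h2 : Continuous fun Y : Matrix (Fin n) (Fin n) ℝ × (Fin m → ℝ) => S.information Y.2 := by
    unfold information
    refine continuous_finsetSum _ fun i _ => ?_
    exact (((continuous_apply i).comp continuous_snd).div_const _).smul continuous_const
  have h3 : ContinuousAt (fun Y : Matrix (Fin n) (Fin n) ℝ × (Fin m → ℝ) =>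
      (S.predict Y.1)⁻¹ + S.information Y.2) (X, p) :=
    (ContinuousAt.comp (f := fun Y : Matrix (Fin n) (Fin n) ℝ × (Fin m → ℝ) => S.predict Y.1)
      (x := (X, p)) (posDef_predict hQ hX).continuousAt_inv h1.continuousAt).add h2.continuousAt
  exact ContinuousAt.comp (x := (X, p))
    (f := fun Y : Matrix (Fin n) (Fin n) ℝ × (Fin m → ℝ) =>
      (S.predict Y.1)⁻¹ + S.information Y.2)
    (posDef_inv_predict_add_information hQ hr hX hp).continuousAt_inv h3

/-- `L(·, p)` is subhomogeneous in the covariance of the prediction. -/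
lemma quadVal_L_le_of_predict_le (hQ : S.Q.PosDef) (hr : ∀ i, 0 < S.r i)
    {X Y : Matrix (Fin n) (Fin n) ℝ} (hX : X.PosSemidef) (hY : Y.PosSemidef)
    {p : Fin m → ℝ} (hp : ∀ i, 0 ≤ p i) {c : ℝ} (hc : 1 ≤ c)
    (h : ∀ x, quadVal (S.predict Y) x ≤ c * quadVal (S.predict X) x) (x : Fin n → ℝ) :
    quadVal (S.L Y p) x ≤ c * quadVal (S.L X p) x := by
  have hc0 : 0 < c := by linarith
  have hMX := posDef_predict hQ hX
  have hNX := posDef_inv_predict_add_information hQ hr hX hp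
  have h1 : ∀ u, c⁻¹ * quadVal (S.predict X)⁻¹ u ≤ quadVal (S.predict Y)⁻¹ u := fun u => by
    rw [← quadVal_smul_inv hc0 hMX]
    exact quadVal_inv_le_quadVal_inv (posDef_predict hQ hY) (hMX.smul hc0)
      (by simpa only [quadVal_smul] using h) u
  -- Shrinking the whole information matrix by `c⁻¹ ≤ 1` also shrinks the measurement part, which
  -- only helps the inequality.
  have h2 := quadVal_inv_le_quadVal_inv (hNX.smul (inv_pos.2 hc0))
    (posDef_inv_predict_add_information hQ hr hY hp) (fun u => by
      rw [quadVal_smul, quadVal_add, quadVal_add, mul_add]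
      have h3 := mul_le_mul_of_nonneg_right (inv_le_one_of_one_le₀ hc)
        ((posSemidef_information hr hp).quadVal_nonneg u)
      linarith [h1 u]) x
  rwa [quadVal_smul_inv (inv_pos.2 hc0) hNX, inv_inv] at h2

/-- `L(·, p)` is monotone in the Loewner order. -/
lemma quadVal_L_mono (hQ : S.Q.PosDef) (hr : ∀ i, 0 < S.r i)
    {X Y : Matrix (Fin n) (Fin n) ℝ} (hX : X.PosSemidef) (hY : Y.PosSemidef)
    {p : Fin m → ℝ} (hp : ∀ i, 0 ≤ p i) (h : ∀ x, quadVal X x ≤ quadVal Y x) (x : Fin n → ℝ) :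
    quadVal (S.L X p) x ≤ quadVal (S.L Y p) x := by
  have := quadVal_L_le_of_predict_le hQ hr hY hX hp le_rfl (fun u => by
    rw [quadVal_predict, quadVal_predict]; linarith [h (S.Aᵀ *ᵥ u)]) x
  linarith

/-- Every estimator `v - C' w` bounds the error covariance `L(X, p)` of the optimal one. -/
lemma quadVal_L_le (hQ : S.Q.PosDef) (hr : ∀ i, 0 < S.r i)
    {X : Matrix (Fin n) (Fin n) ℝ} (hX : X.PosSemidef) {p : Fin m → ℝ} (hp : ∀ i, 0 < p i)
    (v : Fin n → ℝ) (w : Fin m → ℝ) :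
    quadVal (S.L X p) v ≤
      quadVal (S.predict X) (v - S.Cᵀ *ᵥ w) + ∑ i, S.r i / p i * w i ^ 2 := by
  have hN := posDef_inv_predict_add_information hQ hr hX fun i => (hp i).le
  set u := S.L X p *ᵥ v with hu
  have h1 : quadVal (S.L X p) v = v ⬝ᵥ u := rfl
  have h2 : quadVal ((S.predict X)⁻¹ + S.information p) u = v ⬝ᵥ u := by
    rw [quadVal, hu, L_eq, hN.inv_mulVec_mulVec, dotProduct_comm]
  rw [quadVal_add, quadVal_information] at h2
  -- With `u = L(X, p) v` the value `v ⬝ᵥ u` is both the left side and the form of the inverse of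
  -- `L(X, p)` at `u`. Fenchel for the prediction and Young for each sensor bound `2 (v ⬝ᵥ u)` by
  -- the right side plus `v ⬝ᵥ u`.
  have h3 := (posDef_predict hQ hX).two_mul_dotProduct_le (v - S.Cᵀ *ᵥ w) u
  have h4 : (S.Cᵀ *ᵥ w) ⬝ᵥ u = ∑ i, w i * (S.C i ⬝ᵥ u) := by
    rw [mulVec_transpose, ← dotProduct_mulVec]
    rfl
  have h5 : ∑ i, 2 * (w i * (S.C i ⬝ᵥ u)) ≤
      ∑ i, (S.r i / p i * w i ^ 2 + p i / S.r i * (S.C i ⬝ᵥ u) ^ 2) := by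
    refine Finset.sum_le_sum fun i _ => ?_
    have hri := hr i
    have hpi := hp i
    have h6 : S.r i / p i * w i ^ 2 + p i / S.r i * (S.C i ⬝ᵥ u) ^ 2 -
        2 * (w i * (S.C i ⬝ᵥ u)) =
        S.r i / p i * (w i - p i / S.r i * (S.C i ⬝ᵥ u)) ^ 2 := by
      field_simp
      ring
    have h7 : 0 ≤ S.r i / p i * (w i - p i / S.r i * (S.C i ⬝ᵥ u)) ^ 2 := by positivity
    linarith
  rw [← Finset.mul_sum, Finset.sum_add_distrib, ← h4] at h5
  rw [sub_dotProduct] at h3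
  linarith

/-- Contraction towards a fixed point `P` of `L(·, p)`, from above. -/
lemma quadVal_L_le_of_fixed (hQ : S.Q.PosDef) (hr : ∀ i, 0 < S.r i)
    {P X : Matrix (Fin n) (Fin n) ℝ} (hP : P.PosSemidef) (hX : X.PosSemidef)
    {p : Fin m → ℝ} (hp : ∀ i, 0 ≤ p i) (hfix : S.L P p = P) {ε t : ℝ} (hε : ε ≤ 1)
    (hPQ : ∀ x, ε * quadVal (S.predict P) x ≤ quadVal S.Q x) (ht : 1 ≤ t)
    (h : ∀ x, quadVal X x ≤ t * quadVal P x) (x : Fin n → ℝ) :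
    quadVal (S.L X p) x ≤ (1 + (1 - ε) * (t - 1)) * quadVal P x := by
  -- `A X A' + Q ≤ t (A P A' + Q) - (t - 1) Q`, and `Q ≥ ε (A P A' + Q)` leaves the factor `t - ε (t
  -- - 1)`.
  have h1 := quadVal_L_le_of_predict_le hQ hr hP hX hp (c := 1 + (1 - ε) * (t - 1))
    (by nlinarith) (fun u => by
      have h2 := mul_le_mul_of_nonneg_left (hPQ u) (sub_nonneg.2 ht)
      have h3 := h (S.Aᵀ *ᵥ u)
      rw [quadVal_predict] at h2 ⊢
      rw [quadVal_predict]
      linarith) x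
  rwa [hfix] at h1

/-- Contraction towards a fixed point `P` of `L(·, p)`, from below. -/
lemma le_quadVal_L_of_fixed (hQ : S.Q.PosDef) (hr : ∀ i, 0 < S.r i)
    {P X : Matrix (Fin n) (Fin n) ℝ} (hP : P.PosSemidef) (hX : X.PosSemidef)
    {p : Fin m → ℝ} (hp : ∀ i, 0 ≤ p i) (hfix : S.L P p = P) {ε s : ℝ} (hε : 0 < ε) (hε1 : ε ≤ 1)
    (hPQ : ∀ x, ε * quadVal (S.predict P) x ≤ quadVal S.Q x) (hs : 0 ≤ s) (hs1 : s ≤ 1)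
    (h : ∀ x, s * quadVal P x ≤ quadVal X x) (x : Fin n → ℝ) :
    (1 - (1 - ε) * (1 - s)) * quadVal P x ≤ quadVal (S.L X p) x := by
  have hc : 0 < 1 - (1 - ε) * (1 - s) := by nlinarith
  -- `P` and `X` exchange roles: `A X A' + Q ≥ s (A P A' + Q) + (1 - s) Q`. The resulting factor is
  -- at least `ε`, so `s = 0` is allowed.
  have h1 := quadVal_L_le_of_predict_le hQ hr hX hP hp (c := (1 - (1 - ε) * (1 - s))⁻¹)
    (one_le_inv_iff₀.2 ⟨hc, by nlinarith⟩) (fun u => by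
      rw [le_inv_mul_iff₀ hc]
      have h2 := mul_le_mul_of_nonneg_left (hPQ u) (sub_nonneg.2 hs1)
      have h3 := h (S.Aᵀ *ᵥ u)
      rw [quadVal_predict] at h2 ⊢
      rw [quadVal_predict]
      linarith) x
  rwa [hfix, le_inv_mul_iff₀ hc] at h1

/-- A positive definite fixed point of `L(·, p)` attracts all positive semidefinite matrices. -/
theorem hasLimitL_of_fixed (hQ : S.Q.PosDef) (hr : ∀ i, 0 < S.r i)
    {P X : Matrix (Fin n) (Fin n) ℝ} (hP : P.PosDef) (hX : X.PosSemidef)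
    {p : Fin m → ℝ} (hp : ∀ i, 0 ≤ p i) (hfix : S.L P p = P) : S.HasLimitL X p P := by
  obtain ⟨t, ht, hXt⟩ := hP.exists_quadVal_le X
  obtain ⟨d, hd, hQd⟩ := hQ.exists_quadVal_le (S.predict P)
  have hd0 : 0 < d := by linarith
  have hε1 : d⁻¹ ≤ 1 := inv_le_one_of_one_le₀ hd
  have hPQ : ∀ x, d⁻¹ * quadVal (S.predict P) x ≤ quadVal S.Q x := fun x => by
    rw [inv_mul_le_iff₀ hd0]
    exact hQd x
  have hq0 : 0 ≤ 1 - d⁻¹ := by linarith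
  have hq1 : 1 - d⁻¹ < 1 := by linarith [inv_pos.2 hd0]
  have hup : ∀ k x, quadVal (S.iterL k X p) x ≤
      (1 + (1 - d⁻¹) ^ k * (t - 1)) * quadVal P x := by
    intro k
    induction k with
    | zero => intro x; simpa [iterL] using hXt x
    | succ k ih =>
      intro x
      have h := quadVal_L_le_of_fixed hQ hr hP.posSemidef (posSemidef_iterL hQ hr hX hp k) hp
        hfix hε1 hPQ
        (by have := mul_nonneg (pow_nonneg hq0 k) (sub_nonneg.2 ht); linarith) ih x
      rw [iterL_succ]
      convert h using 2
      ring
  -- The lower bound starts from `s = 0`, so singular `X` are covered.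
  have hlow : ∀ k x, (1 - (1 - d⁻¹) ^ k) * quadVal P x ≤ quadVal (S.iterL k X p) x := by
    intro k
    induction k with
    | zero => intro x; simpa [iterL] using hX.quadVal_nonneg x
    | succ k ih =>
      intro x
      have h := le_quadVal_L_of_fixed hQ hr hP.posSemidef (posSemidef_iterL hQ hr hX hp k) hp
        hfix (inv_pos.2 hd0) hε1 hPQ (by linarith [pow_le_one₀ (n := k) hq0 hq1.le])
        (by linarith [pow_nonneg hq0 k]) ih x
      rw [iterL_succ]
      convert h using 2
      ring
  have hpow := tendsto_pow_atTop_nhds_zero_of_lt_one hq0 hq1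
  refine tendsto_of_tendsto_quadVal (fun k => (posSemidef_iterL hQ hr hX hp k).1) hP.1 fun x => ?_
  refine tendsto_of_tendsto_of_tendsto_of_le_of_le ?_ ?_ (fun k => hlow k x) (fun k => hup k x)
  · simpa using (hpow.const_sub 1).mul_const (quadVal P x)
  · simpa using ((hpow.mul_const (t - 1)).const_add 1).mul_const (quadVal P x)

/-- The limit of the iterates of `L(·, p)` is a fixed point. -/
lemma L_eq_of_hasLimitL (hQ : S.Q.PosDef) (hr : ∀ i, 0 < S.r i)
    {X P : Matrix (Fin n) (Fin n) ℝ} (hX : X.PosSemidef) {p : Fin m → ℝ} (hp : ∀ i, 0 ≤ p i)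
    (h : S.HasLimitL X p P) : P.PosDef ∧ S.L P p = P := by
  have h' : Tendsto (fun k => S.iterL k X p) atTop (𝓝 P) := h
  have hP : P.PosSemidef := Matrix.PosSemidef.of_tendsto (posSemidef_iterL hQ hr hX hp) h'
  have h1 : Tendsto (fun k => S.L (S.iterL k X p) p) atTop (𝓝 (S.L P p)) :=
    Tendsto.comp (f := fun k => (S.iterL k X p, p)) (continuousAt_L hQ hr hP hp)
      (h'.prodMk_nhds tendsto_const_nhds)
  have h3 : Tendsto (fun k => S.iterL (k + 1) X p) atTop (𝓝 P) :=
    h'.comp (tendsto_add_atTop_nat 1)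
  simp only [iterL_succ] at h3
  have h2 : S.L P p = P := tendsto_nhds_unique h1 h3
  -- A limit is only known to be semidefinite, but values of `L` are definite and `P` is one.
  have h4 := posDef_L hQ hr hP hp
  rw [h2] at h4
  exact ⟨h4, h2⟩

/-- Observability in dual form: the ranges of `(A')^i C'` span the whole space. -/
lemma iSup_map_pow_eq_top (hobs : IsObservable S.C S.A) :
    ⨆ i, (LinearMap.range S.Cᵀ.mulVecLin).map (S.Aᵀ.mulVecLin ^ i) = ⊤ := by
  by_contra hne
  -- A nonzero functional `x ⬝ᵥ ·` vanishing on all these ranges would give `C A ^ k x = 0` for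
  -- every `k`.
  obtain ⟨f, hf0, hf⟩ := Submodule.exists_le_ker_of_lt_top _ (lt_top_iff_ne_top.2 hne)
  obtain ⟨x, rfl⟩ := (dotProductEquiv ℝ (Fin n)).surjective f
  refine hf0 ?_
  rw [map_eq_zero_iff _ (dotProductEquiv ℝ (Fin n)).injective]
  refine hobs x fun k => dotProduct_eq_zero _ fun w => ?_
  have hmem : (S.Aᵀ.mulVecLin ^ k) (S.Cᵀ *ᵥ w) ∈
      ⨆ i, (LinearMap.range S.Cᵀ.mulVecLin).map (S.Aᵀ.mulVecLin ^ i) :=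
    Submodule.mem_iSup_of_mem k (Submodule.mem_map_of_mem ⟨w, rfl⟩)
  have h := hf hmem
  have hpow : (S.Aᵀ.mulVecLin ^ k) = (S.A ^ k)ᵀ.mulVecLin := by
    rw [transpose_pow]
    exact (Matrix.toLin'_pow S.Aᵀ k).symm
  simp only [LinearMap.mem_ker, dotProductEquiv_apply_apply, hpow, mulVecLin_apply,
    mulVec_mulVec, ← transpose_mul] at h
  rwa [mulVec_transpose, dotProduct_comm, ← dotProduct_mulVec, dotProduct_comm] at h

/-- A subspace that contains every vector that `A'(v - C' w)` maps into it, for some `w`, is the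
whole space. -/
lemma eq_top_of_observable (hobs : IsObservable S.C S.A) (B : Submodule ℝ (Fin n → ℝ))
    (hB : ∀ v w, S.Aᵀ *ᵥ (v - S.Cᵀ *ᵥ w) ∈ B → v ∈ B) : B = ⊤ := by
  set R := LinearMap.range S.Cᵀ.mulVecLin
  set a := S.Aᵀ.mulVecLin
  let W : ℕ →o Submodule ℝ (Fin n → ℝ) :=
    ⟨fun j => ⨆ i, ⨆ (_ : i < j), R.map (a ^ i), fun j k hjk =>
      iSup_mono fun i => iSup_mono' fun hi => ⟨hi.trans_le hjk, le_rfl⟩⟩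
  have hWsucc : ∀ j, W (j + 1) = W j ⊔ R.map (a ^ j) := fun j => by
    change (⨆ i, ⨆ (_ : i < j + 1), R.map (a ^ i)) = _
    rw [Nat.iSup_lt_succ]
    rfl
  obtain ⟨J, hJ⟩ : ∃ J, W J = ⊤ := by
    refine ⟨_, (WellFoundedGT.iSup_eq_monotonicSequenceLimit W).symm.trans ?_⟩
    rw [← top_le_iff, ← iSup_map_pow_eq_top hobs]
    refine iSup_le fun i => le_trans ?_ (le_iSup W (i + 1))
    rw [hWsucc]
    exact le_sup_right
  -- Deadbeat control: `W j` is the sum of the ranges of `(A')^i C'` for `i < j`. Each choice of `w`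
  -- removes the term with the highest power, and after `j` steps the vector is `0`, which lies in
  -- `B`.
  have key : ∀ j v, (a ^ j) v ∈ (W j).map a → v ∈ B := by
    intro j
    induction j with
    | zero =>
      intro v hv
      have : W 0 = ⊥ := by
        change (⨆ i, ⨆ (_ : i < 0), R.map (a ^ i)) = _
        simp
      rw [this] at hv
      have : v = 0 := by simpa using hv
      rw [this]
      exact B.zero_mem
    | succ j ih =>
      intro v hv
      rw [hWsucc, Submodule.map_sup, Submodule.mem_sup] at hv
      obtain ⟨y, hy, z, ⟨z', ⟨_, ⟨w, rfl⟩, rfl⟩, rfl⟩, hyz⟩ := hv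
      refine hB v w (ih _ ?_)
      have h1 : (a ^ j) (a (v - S.Cᵀ *ᵥ w)) = y := by
        rw [map_sub, map_sub]
        have h2 : (a ^ (j + 1)) v = (a ^ j) (a v) := by rw [pow_succ]; rfl
        have h3 : a ((a ^ j) (S.Cᵀ *ᵥ w)) = (a ^ j) (a (S.Cᵀ *ᵥ w)) := by
          change (a * a ^ j) _ = (a ^ j * a) _
          rw [← pow_succ, ← pow_succ']
        rw [← h2, ← h3, ← hyz]
        exact add_sub_cancel_right _ _
      rw [show S.Aᵀ *ᵥ (v - S.Cᵀ *ᵥ w) = a (v - S.Cᵀ *ᵥ w) from rfl, h1]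
      exact hy
  -- One initial step with `w = 0` replaces `v` by `A' v`, because `key` needs a vector in the image
  -- of `W J` under `A'`.
  refine eq_top_iff.2 fun v _ => hB v 0 (key J _ ?_)
  rw [hJ, mulVec_zero, sub_zero]
  change (a ^ J * a) v ∈ _
  rw [← pow_succ, pow_succ']
  exact ⟨(a ^ J) v, trivial, rfl⟩

/-- For an observable pair and positive marginals, `L(·, p)` has a positive definite fixed
point. -/
theorem exists_fixed (hQ : S.Q.PosDef) (hr : ∀ i, 0 < S.r i) (hobs : IsObservable S.C S.A)
    {p : Fin m → ℝ} (hp : ∀ i, 0 < p i) :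
    ∃ P : Matrix (Fin n) (Fin n) ℝ, P.PosDef ∧ S.L P p = P := by
  have hp' : ∀ i, 0 ≤ p i := fun i => (hp i).le
  have hpsd := posSemidef_iterL hQ hr (PosSemidef.zero : (0 : Matrix (Fin n) (Fin n) ℝ).PosSemidef)
    hp'
  have hstep : ∀ k x, quadVal (S.iterL k 0 p) x ≤ quadVal (S.iterL (k + 1) 0 p) x := by
    intro k
    induction k with
    | zero =>
      intro x
      simpa [iterL, quadVal] using (hpsd 1).quadVal_nonneg x
    | succ k ih =>
      intro x
      rw [iterL_succ, iterL_succ (k + 1)]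
      exact quadVal_L_mono hQ hr (hpsd k) (hpsd (k + 1)) hp' ih x
  have hmono : ∀ x, Monotone fun k => quadVal (S.iterL k 0 p) x := fun x =>
    monotone_nat_of_le_succ fun k => hstep k x
  -- The directions in which the iterates stay bounded.
  let B : Submodule ℝ (Fin n → ℝ) :=
    { carrier := {v | ∃ c, ∀ k, quadVal (S.iterL k 0 p) v ≤ c}
      add_mem' := by
        rintro v w ⟨c, hc⟩ ⟨d, hd⟩
        exact ⟨2 * c + 2 * d, fun k => (quadVal_add_vec_le (hpsd k) v w).trans
          (by linarith [hc k, hd k])⟩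
      zero_mem' := ⟨0, fun k => by simp⟩
      smul_mem' := by
        rintro a v ⟨c, hc⟩
        exact ⟨a ^ 2 * c, fun k => by
          rw [quadVal_smul_vec]
          exact mul_le_mul_of_nonneg_left (hc k) (sq_nonneg a)⟩ }
  have hB : B = ⊤ := by
    refine eq_top_of_observable hobs B ?_
    rintro v w ⟨c, hc⟩
    refine ⟨c + quadVal S.Q (v - S.Cᵀ *ᵥ w) + ∑ i, S.r i / p i * w i ^ 2, fun k => ?_⟩
    -- Passing to iterate `k + 1` allows a bound by iterate `k` at `A' (v - C' w)`, plus a constant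
    -- independent of `k`.
    refine (hstep k v).trans ?_
    rw [iterL_succ]
    refine (quadVal_L_le hQ hr (hpsd k) hp v w).trans ?_
    rw [quadVal_predict]
    linarith [hc k]
  obtain ⟨P, hP⟩ := exists_tendsto_of_monotone hpsd hmono fun x =>
    (by rw [hB]; trivial : x ∈ B)
  exact ⟨P, L_eq_of_hasLimitL hQ hr PosSemidef.zero hp' hP⟩

end Riccati

end SensorModel

/-! ### Directed trees -/

section DirectedTree

variable {V : Type*}

/-- An edge leaving the root, continued by the path from its head back to the root, would be a
second path from the root to itself. -/
lemma IsDirectedTree.fst_ne_root {s : V} {W : Finset V} {E : Finset (V × V)}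
    (h : IsDirectedTree s W E) {e : V × V} (he : e ∈ E) : e.1 ≠ s := by
  rintro rfl
  obtain ⟨l, ⟨hl1, hl2, hl3⟩, -⟩ := h.2.2 e.2 (h.2.1 e he).2
  obtain ⟨l', -, huniq⟩ := h.2.2 e.1 h.1
  cases l with
  | nil => simp at hl1
  | cons b t =>
    obtain rfl : b = e.2 := by simpa using hl1
    have h1 := huniq [e.1] ⟨by simp, by simp, by simp⟩
    have h2 := huniq (e.1 :: e.2 :: t)
      ⟨by simp, by simpa using hl2, List.isChain_cons_cons.2 ⟨he, hl3⟩⟩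
    simp [← h1] at h2

lemma isDirectedTree_singleton (s : V) : IsDirectedTree s {s} ∅ := by
  refine ⟨by simp, by simp, fun u hu => ?_⟩
  obtain rfl : u = s := by simpa using hu
  refine ⟨[u], ⟨by simp, by simp, by simp⟩, ?_⟩
  rintro l ⟨h1, -, h3⟩
  match l, h1, h3 with
  | [a], h1, _ => simpa using h1
  | a :: b :: t, _, h3 => simp at h3

end DirectedTree

/-! ### The set of feasible marginals -/

namespace SensorModel

section FeasibleMarginals

variable {n m : ℕ} (S : SensorModel n m)

/-- Edges are grouped by their tail, and no edge has the root as its tail. This makes the energy of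
the full tree equal to the sum of the sensor costs. -/
lemma sum_sensorCost (htree : IsDirectedTree 0 Finset.univ S.edges) :
    ∑ i, S.sensorCost i = ∑ e ∈ S.edges, S.cost e := by
  have h := Finset.sum_fiberwise S.edges (fun e => e.1) S.cost
  rw [Fin.sum_univ_succ, Finset.filter_false_of_mem fun e he => htree.fst_ne_root he] at h
  simpa [sensorCost] using h

lemma nonneg_of_mem_feasibleMarginals {p : Fin m → ℝ} (hp : p ∈ S.feasibleMarginals) (i : Fin m) :
    0 ≤ p i := by
  obtain ⟨π, -, h0, -, hpi⟩ := hp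
  rw [hpi]
  exact Finset.sum_nonneg fun T hT => h0 T (Finset.mem_of_mem_filter T hT)

/-- The marginals are the continuous image of a compact set of probability weights. -/
lemma isCompact_feasibleMarginals : IsCompact S.feasibleMarginals := by
  classical
  let K : Set (Finset (Fin (m + 1)) × Finset (Fin (m + 1) × Fin (m + 1)) → ℝ) :=
    Set.univ.pi (fun _ => Set.Icc 0 1) ∩
      ({π | ∑ T ∈ S.trees, π T * S.energy T ≤ S.budget} ∩ {π | ∑ T ∈ S.trees, π T = 1})
  have hK : IsCompact K := by
    refine (isCompact_univ_pi fun _ => isCompact_Icc).inter_right (IsClosed.inter ?_ ?_)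
    · exact isClosed_le (by fun_prop) continuous_const
    · exact isClosed_eq (by fun_prop) continuous_const
  let f : (Finset (Fin (m + 1)) × Finset (Fin (m + 1) × Fin (m + 1)) → ℝ) → Fin m → ℝ :=
    fun π i => ∑ T ∈ S.trees with i.succ ∈ T.1, π T
  have hf : Continuous f := by
    unfold f
    fun_prop
  convert hK.image hf
  ext p
  constructor
  · rintro ⟨π, h1, h2, h3, h4⟩
    -- Weights off `S.trees` are unconstrained in the definition; setting them to `0` puts `π` in
    -- the box.
    refine ⟨fun T => if T ∈ S.trees then π T else 0, ⟨fun T _ => ?_, ?_, ?_⟩, ?_⟩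
    · by_cases hT : T ∈ S.trees
      · simpa only [hT, if_true, Set.mem_Icc] using
          ⟨h2 T hT, h3 ▸ Finset.single_le_sum h2 hT⟩
      · simp [hT]
    · refine le_trans (le_of_eq (Finset.sum_congr rfl fun T hT => ?_)) h1
      simp [hT]
    · refine (Finset.sum_congr rfl fun T hT => ?_).trans h3
      simp [hT]
    · funext i
      rw [h4 i]
      refine Finset.sum_congr rfl fun T hT => ?_
      simp [Finset.mem_of_mem_filter T hT]
  · rintro ⟨π, ⟨h0, h1, h2⟩, rfl⟩
    exact ⟨π, h1, fun T _ => (h0 T trivial).1, h2, fun i => rfl⟩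

lemma initialMarginals_mem (htree : IsDirectedTree 0 Finset.univ S.edges)
    (hpos : 0 < S.budget) (hle : S.budget ≤ ∑ i, S.sensorCost i) :
    S.initialMarginals ∈ S.feasibleMarginals := by
  classical
  have hc : 0 < ∑ i, S.sensorCost i := hpos.trans_le hle
  set θ := S.budget / ∑ i, S.sensorCost i with hθ
  have hθ0 : 0 ≤ θ := (div_pos hpos hc).le
  have hθ1 : θ ≤ 1 := (div_le_one hc).2 hle
  have hfull : (Finset.univ, S.edges) ∈ S.trees := by simp [trees, htree]
  have htriv : ({0}, ∅) ∈ S.trees := by simp [trees, isDirectedTree_singleton]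
  -- The full tree gets weight `θ` and the bare root `1 - θ`: the expected energy is exactly the
  -- budget, and each sensor is selected with probability `θ`.
  refine ⟨fun T => (if T = (Finset.univ, S.edges) then θ else 0) +
    (if T = ({0}, ∅) then 1 - θ else 0), ?_, fun T _ => ?_, ?_, fun i => ?_⟩
  · simp only [add_mul, ite_mul, zero_mul, Finset.sum_add_distrib, Finset.sum_ite_eq', hfull,
      htriv, if_true, energy, Finset.sum_empty, mul_zero, add_zero]
    rw [← S.sum_sensorCost htree, hθ, div_mul_cancel₀ _ hc.ne']
  · have := sub_nonneg.2 hθ1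
    positivity
  · simp [Finset.sum_add_distrib, hfull, htriv]
  · simp [Finset.sum_add_distrib, hfull, initialMarginals, hθ]

end FeasibleMarginals

end SensorModel

/-! ### Feasibility and limits of the algorithm -/

namespace SensorModel

section Algorithm

variable {n m : ℕ} {S : SensorModel n m}

/-- The subproblem with a positive definite previous matrix has a solution if it is feasible. -/
lemma exists_isSubproblemSolution (hQ : S.Q.PosDef) (hr : ∀ i, 0 < S.r i)
    {Y : Matrix (Fin n) (Fin n) ℝ} (hY : Y.PosDef) (hne : (S.subproblemSet Y).Nonempty) :
    ∃ q, S.IsSubproblemSolution Y q := by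
  have hcont : ContinuousOn (fun q => S.L Y q) S.feasibleMarginals := fun q hq =>
    (ContinuousAt.comp (f := fun q : Fin m → ℝ => (Y, q)) (x := q)
      (continuousAt_L hQ hr hY.posSemidef (S.nonneg_of_mem_feasibleMarginals hq))
      (by fun_prop)).continuousWithinAt
  have hset : S.subproblemSet Y =
      S.feasibleMarginals ∩ (fun q => S.L Y q) ⁻¹'
        {M | ∀ x, quadVal M x ≤ quadVal Y x} := by
    ext q
    refine and_congr_right fun hq => ?_
    exact posSemidef_sub_iff
      (posDef_L hQ hr hY.posSemidef (S.nonneg_of_mem_feasibleMarginals hq)).1 hY.1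
  have hclosed : IsClosed {M : Matrix (Fin n) (Fin n) ℝ | ∀ x, quadVal M x ≤ quadVal Y x} := by
    simp only [Set.ofPred_forall]
    exact isClosed_iInter fun x => isClosed_le (continuous_quadVal_matrix x) continuous_const
  have hcompact : IsCompact (S.subproblemSet Y) := by
    have h := hcont.preimage_isClosed_of_isClosed S.isCompact_feasibleMarginals.isClosed hclosed
    rw [← hset] at h
    exact S.isCompact_feasibleMarginals.of_isClosed_subset h fun q hq => hq.1
  obtain ⟨q, hq, hmin⟩ := hcompact.exists_isMinOn hne
    (f := fun q => (S.L Y q).trace)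
    ((Continuous.matrix_trace continuous_id).comp_continuousOn
      (hcont.mono fun q hq => hq.1))
  exact ⟨q, hq, fun q' hq' => hmin hq'⟩

/-- A feasible point of the subproblem remains feasible after the step it defines. -/
lemma mem_subproblemSet_L (hQ : S.Q.PosDef) (hr : ∀ i, 0 < S.r i)
    {Y : Matrix (Fin n) (Fin n) ℝ} (hY : Y.PosDef) {q : Fin m → ℝ} (hq : q ∈ S.subproblemSet Y) :
    q ∈ S.subproblemSet (S.L Y q) := by
  have hq0 := S.nonneg_of_mem_feasibleMarginals hq.1
  have hL := posDef_L hQ hr hY.posSemidef hq0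
  refine ⟨hq.1, (posSemidef_sub_iff (posDef_L hQ hr hL.posSemidef hq0).1 hL.1).2 ?_⟩
  -- Apply the monotone map `L(·, q)` to `L(Y, q) ≤ Y`.
  exact quadVal_L_mono hQ hr hL.posSemidef hY.posSemidef hq0
    ((posSemidef_sub_iff hL.1 hY.1).1 hq.2)

lemma mem_subproblemSet_of_fixed {Y : Matrix (Fin n) (Fin n) ℝ} {q : Fin m → ℝ}
    (hq : q ∈ S.feasibleMarginals) (h : S.L Y q = Y) : q ∈ S.subproblemSet Y :=
  ⟨hq, by rw [h, sub_self]; exact Matrix.PosSemidef.zero⟩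

/-- Throughout the algorithm the matrices are positive definite and the last marginals are
feasible for the next subproblem. -/
lemma IsRunUpTo.posDef_and_mem (hQ : S.Q.PosDef) (hr : ∀ i, 0 < S.r i)
    (hinit : S.initialMarginals ∈ S.feasibleMarginals)
    {N : ℕ} {Lk : ℕ → Matrix (Fin n) (Fin n) ℝ} {pk : ℕ → Fin m → ℝ} (h : S.IsRunUpTo N Lk pk)
    {k : ℕ} (hk : k ≤ N) : (Lk k).PosDef ∧ pk k ∈ S.subproblemSet (Lk k) := by
  induction k with
  | zero =>
    obtain ⟨hP, hfix⟩ := L_eq_of_hasLimitL hQ hr Matrix.PosSemidef.one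
      (S.nonneg_of_mem_feasibleMarginals hinit) h.2.1
    rw [h.1]
    exact ⟨hP, mem_subproblemSet_of_fixed hinit hfix⟩
  | succ k ih =>
    obtain ⟨hP, -⟩ := ih (by omega)
    obtain ⟨hsol, hL⟩ := h.2.2 k (by omega)
    rw [hL]
    exact ⟨posDef_L hQ hr hP.posSemidef (S.nonneg_of_mem_feasibleMarginals hsol.1.1),
      mem_subproblemSet_L hQ hr hP hsol.1⟩

/-- The subtype carries the invariant (definite, with feasible subproblem) under which a minimizer
can be chosen at each step. -/
lemma exists_isRun (hQ : S.Q.PosDef) (hr : ∀ i, 0 < S.r i)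
    (hinit : S.initialMarginals ∈ S.feasibleMarginals) {L₀ : Matrix (Fin n) (Fin n) ℝ}
    (hL₀ : S.HasLimitL 1 S.initialMarginals L₀) : ∃ Lk pk, S.IsRun Lk pk := by
  obtain ⟨hP, hfix⟩ := L_eq_of_hasLimitL hQ hr Matrix.PosSemidef.one
    (S.nonneg_of_mem_feasibleMarginals hinit) hL₀
  have hex : ∀ Y : {Y : Matrix (Fin n) (Fin n) ℝ // Y.PosDef ∧ (S.subproblemSet Y).Nonempty},
      ∃ q, S.IsSubproblemSolution Y.1 q := fun Y =>
    exists_isSubproblemSolution hQ hr Y.2.1 Y.2.2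
  choose sol hsol using hex
  let step : {Y : Matrix (Fin n) (Fin n) ℝ // Y.PosDef ∧ (S.subproblemSet Y).Nonempty} →
      {Y : Matrix (Fin n) (Fin n) ℝ // Y.PosDef ∧ (S.subproblemSet Y).Nonempty} := fun Y =>
    ⟨S.L Y.1 (sol Y), posDef_L hQ hr Y.2.1.posSemidef
      (S.nonneg_of_mem_feasibleMarginals (hsol Y).1.1),
      ⟨_, mem_subproblemSet_L hQ hr Y.2.1 (hsol Y).1⟩⟩
  let Y₀ : {Y : Matrix (Fin n) (Fin n) ℝ // Y.PosDef ∧ (S.subproblemSet Y).Nonempty} :=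
    ⟨L₀, hP, ⟨_, mem_subproblemSet_of_fixed hinit hfix⟩⟩
  refine ⟨fun k => (step^[k] Y₀).1, fun k => Nat.casesOn k S.initialMarginals
    fun k => sol (step^[k] Y₀), fun N => ⟨rfl, hL₀, fun k _ => ⟨hsol _, ?_⟩⟩⟩
  change (step^[k + 1] Y₀).1 = (step (step^[k] Y₀)).1
  rw [Function.iterate_succ_apply']

/-- The whole sequence converges, so along the subsequence both `L_k` and its predecessor tend to
`M`; continuity of `L` at `(M, pstar)` gives the fixed point equation. -/
lemma IsRun.L_eq_of_isAccumulationPoint (hQ : S.Q.PosDef) (hr : ∀ i, 0 < S.r i)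
    {Lk : ℕ → Matrix (Fin n) (Fin n) ℝ} {pk : ℕ → Fin m → ℝ} (h : S.IsRun Lk pk)
    {M : Matrix (Fin n) (Fin n) ℝ} (hM : M.PosSemidef) (hlim : Tendsto Lk atTop (𝓝 M))
    {pstar : Fin m → ℝ} (hp : ∀ i, 0 ≤ pstar i) (hacc : IsAccumulationPoint pk pstar) :
    S.L M pstar = M := by
  obtain ⟨φ, hφ, hφlim⟩ := hacc
  -- The shift to `j + 1` ensures `φ (j + 1) ≥ 1`, so the truncated subtraction gives the true
  -- predecessor.
  have hsucc : ∀ j, Lk (φ (j + 1)) = S.L (Lk (φ (j + 1) - 1)) (pk (φ (j + 1))) := fun j => by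
    have h1 : 1 ≤ φ (j + 1) := (Nat.le_add_left 1 j).trans (hφ.id_le _)
    obtain ⟨k, hk⟩ := Nat.exists_eq_add_of_le' h1
    rw [hk]
    exact ((h (k + 1)).2.2 k (Nat.lt_succ_self k)).2
  have hφ' : Tendsto (fun j => φ (j + 1)) atTop atTop :=
    hφ.tendsto_atTop.comp (tendsto_add_atTop_nat 1)
  have h1 : Tendsto (fun j => Lk (φ (j + 1))) atTop (𝓝 M) := hlim.comp hφ'
  have h2 : Tendsto (fun j => Lk (φ (j + 1) - 1)) atTop (𝓝 M) :=
    hlim.comp ((tendsto_sub_atTop_nat 1).comp hφ')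
  have h3 : Tendsto (fun j => pk (φ (j + 1))) atTop (𝓝 pstar) :=
    hφlim.comp (tendsto_add_atTop_nat 1)
  have h4 : Tendsto (fun j => S.L (Lk (φ (j + 1) - 1)) (pk (φ (j + 1)))) atTop
      (𝓝 (S.L M pstar)) :=
    Tendsto.comp (f := fun j => (Lk (φ (j + 1) - 1), pk (φ (j + 1))))
      (continuousAt_L hQ hr hM hp) (h2.prodMk_nhds h3)
  simp only [← hsucc] at h4
  exact tendsto_nhds_unique h4 h1

end Algorithm

end SensorModel

/-! ### Convergence of the algorithm -/

theorem mainTheorem2 {n m : ℕ} (S : SensorModel n m)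
    (hQ : S.Q.PosDef) (hr : ∀ i, 0 < S.r i)
    (hobs : IsObservable S.C S.A)
    (htree : IsDirectedTree 0 Finset.univ S.edges)
    (hbudget_pos : 0 < S.budget) (hbudget_le : S.budget ≤ ∑ i, S.sensorCost i) :
    -- (1) the initial matrix exists
    (∃ L₀, S.HasLimitL 1 S.initialMarginals L₀) ∧
    -- (2) the subproblem is feasible, and has a solution, after any number of steps
    (∀ (N : ℕ) (Lk : ℕ → Matrix (Fin n) (Fin n) ℝ) (pk : ℕ → Fin m → ℝ),
      S.IsRunUpTo N Lk pk →
        (S.subproblemSet (Lk N)).Nonempty ∧ ∃ q, S.IsSubproblemSolution (Lk N) q) ∧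
    (∃ Lk pk, S.IsRun Lk pk) ∧
    ∀ (Lk : ℕ → Matrix (Fin n) (Fin n) ℝ) (pk : ℕ → Fin m → ℝ), S.IsRun Lk pk →
      -- (3) accumulation points exist and are feasible
      (∃ pstar, IsAccumulationPoint pk pstar) ∧
      (∀ pstar, IsAccumulationPoint pk pstar → pstar ∈ S.feasibleMarginals) ∧
      -- (4) the matrices decrease and converge; (5) the limit is `L^∞(X, pstar)` for all `X ≥ 0`
      (∀ k, (Lk k - Lk (k + 1)).PosSemidef) ∧
      ∃ Linf, Tendsto Lk atTop (𝓝 Linf) ∧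
        ∀ pstar, IsAccumulationPoint pk pstar →
          ∀ X : Matrix (Fin n) (Fin n) ℝ, X.PosSemidef → S.HasLimitL X pstar Linf := by
  have hinit := S.initialMarginals_mem htree hbudget_pos hbudget_le
  have hinit_pos : ∀ i, 0 < S.initialMarginals i := fun _ =>
    div_pos hbudget_pos (hbudget_pos.trans_le hbudget_le)
  obtain ⟨P, hP, hPfix⟩ := SensorModel.exists_fixed hQ hr hobs hinit_pos
  have hP0 : S.HasLimitL 1 S.initialMarginals P := SensorModel.hasLimitL_of_fixed hQ hr hP
    Matrix.PosSemidef.one (fun i => (hinit_pos i).le) hPfix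
  refine ⟨⟨P, hP0⟩, fun N Lk pk h => ?_, SensorModel.exists_isRun hQ hr hinit hP0,
    fun Lk pk h => ?_⟩
  · obtain ⟨h1, h2⟩ := h.posDef_and_mem hQ hr hinit le_rfl
    exact ⟨⟨_, h2⟩, SensorModel.exists_isSubproblemSolution hQ hr h1 ⟨_, h2⟩⟩
  have hinv := fun k => (h k).posDef_and_mem hQ hr hinit le_rfl
  have hacc : ∀ pstar, IsAccumulationPoint pk pstar → pstar ∈ S.feasibleMarginals := by
    rintro pstar ⟨φ, -, hφ⟩
    exact S.isCompact_feasibleMarginals.isClosed.mem_of_tendsto hφ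
      (Eventually.of_forall fun j => (hinv (φ j)).2.1)
  have hdec : ∀ k, (Lk k - Lk (k + 1)).PosSemidef := fun k => by
    obtain ⟨h1, h2⟩ := (h (k + 1)).2.2 k (Nat.lt_succ_self k)
    rw [h2]
    exact h1.1.2
  refine ⟨?_, hacc, hdec, ?_⟩
  · obtain ⟨pstar, -, φ, hφ, hlim⟩ :=
      S.isCompact_feasibleMarginals.tendsto_subseq fun k => (hinv k).2.1
    exact ⟨pstar, φ, hφ, hlim⟩
  · obtain ⟨M, hM⟩ := exists_tendsto_of_antitone (fun k => (hinv k).1.posSemidef) fun x =>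
      antitone_nat_of_succ_le fun k =>
        (posSemidef_sub_iff (hinv (k + 1)).1.1 (hinv k).1.1).1 (hdec k) x
    have hMpsd := Matrix.PosSemidef.of_tendsto (fun k => (hinv k).1.posSemidef) hM
    refine ⟨M, hM, fun pstar hpstar X hX => ?_⟩
    have hp := S.nonneg_of_mem_feasibleMarginals (hacc pstar hpstar)
    have hfix := h.L_eq_of_isAccumulationPoint hQ hr hMpsd hM hp hpstar
    have hMpd := SensorModel.posDef_L hQ hr hMpsd hp
    rw [hfix] at hMpd
    exact SensorModel.hasLimitL_of_fixed hQ hr hMpd hX hp hfix
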